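/- Let $G$ be a finite group and $K\le G$ a subgroup such that $(G,K)$ is a Gelfand pair, that is, the convolution algebra of $K$ bi-invariant functions $G\to\mathbb{C}$ is commutative, where $(f*h)(g)=\sum_{u\in G}f(u)h(u^{-1}g)$. Let $X=G/K$ be the set of left cosets $gK$ with the left action of $G$. A $K$ bi-invariant function $\varphi:G\to\mathbb{C}$ is called spherical if $\varphi(\mathrm{id}_G)=1$ and $\varphi*f=\big((\varphi*f)(\mathrm{id}_G)\big)\,\varphi$ for every $K$ bi-invariant $f$. Let $\varphi_0,\dots,\varphi_N$ be the distinct spherical functions, with $\varphi_0\equiv 1$, regarded as functions on $X$, and let $d_i$ be the dimension of the space of functions on $X$ spanned by the translates $x\mapsto\varphi_i(g^{-1}x)$, $g\in G$. Let $\bar x\in X$ be stabilised by $K$, i.e. $k\bar x=\bar x$ for all $k\in K$. Let $P$ be a stochastic matrix on $X$ that is $G$-invariant, i.e. $P(gx,gy)=P(x,y)$ for all $g\in G$ and $x,y\in X$, and put $\mu(\cdot)=P(\bar x,\cdot)$ and $$\widetilde\mu(i)=\sum_{x\in X}\mu(x)\overline{\varphi_i(x)}.$$ Write $d_{\mathrm{TV}}(\alpha,\beta)=\tfrac12\sum_{x\in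 X}|\alpha(x)-\beta(x)|$, and let $\mathrm{Unif}_X$ be the uniform distribution on $X$. Let $\mu^{*t}$ be the $t$-fold self-convolution of $\mu$ on $X$, where $(\alpha*\beta)(x)=|K|^{-1}\sum_{u\in G}\alpha(uK)\beta(u^{-1}x)$ and $\mu^{*0}$ is the point mass at the coset $K$. Then for every integer $t\ge 0$ and every $I\subseteq\{1,\dots,N\}$, $$d_{\mathrm{TV}}\big(P^t(\bar x,\cdot),\mathrm{Unif}_X\big)=d_{\mathrm{TV}}\big(\mu^{*t},\mathrm{Unif}_X\big)$$ and $$\Big|\,d_{\mathrm{TV}}\big(P^t(\bar x,\cdot),\mathrm{Unif}_X\big)-\tfrac12|X|^{-1}\sum_{x\in X}\Big|\sum_{i\in I}d_i\varphi_i(x)\,\widetilde\mu(i)^t\Big|\,\Big|\le\tfrac12\sum_{i\in\{1,\dots,N\}\setminus I}\sqrt{d_i}\,|\widetilde\mu(i)|^t.$$ -/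

import Mathlib

namespace GelfandWalk

/-- `f : G → ℂ` is `K` bi-invariant. -/
def IsBiInvariant {G : Type*} [Group G] (K : Subgroup G) (f : G → ℂ) : Prop :=
  ∀ k₁ ∈ K, ∀ k₂ ∈ K, ∀ g : G, f (k₁ * g * k₂) = f g

/-- Convolution of complex functions on a finite group:
`(f * h)(g) = ∑ u, f u * h (u⁻¹ g)`. -/
def conv {G : Type*} [Group G] [Fintype G] (f h : G → ℂ) : G → ℂ :=
  fun g => ∑ u : G, f u * h (u⁻¹ * g)

/-- `(G, K)` is a Gelfand pair: the convolution algebra of `K` bi-invariant functions on `G`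
is commutative. -/
def IsGelfandPair (G : Type*) [Group G] [Fintype G] (K : Subgroup G) : Prop :=
  ∀ f h : G → ℂ, IsBiInvariant K f → IsBiInvariant K h → conv f h = conv h f

/-- A `K` bi-invariant `φ : G → ℂ` is spherical if `φ(1) = 1` and `φ * f = ((φ * f)(1)) φ` for
every `K` bi-invariant `f`. -/
def IsSpherical {G : Type*} [Group G] [Fintype G] (K : Subgroup G) (φ : G → ℂ) : Prop :=
  IsBiInvariant K φ ∧ φ 1 = 1 ∧
    ∀ f : G → ℂ, IsBiInvariant K f → conv φ f = (conv φ f 1) • φ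

/-- The function on `G` corresponding to a function on `X = G ⧸ K`: `g ↦ f (g K)`. -/
def lift {G : Type*} [Group G] (K : Subgroup G) (f : G ⧸ K → ℂ) : G → ℂ :=
  fun g => f (g : G ⧸ K)

/-- The subspace of `L(X)` spanned by the `G`-translates `x ↦ φ (g⁻¹ x)` of `φ ∈ L(X)`. -/
def translateSpan {G : Type*} [Group G] (K : Subgroup G) (φ : G ⧸ K → ℂ) :
    Submodule ℂ (G ⧸ K → ℂ) :=
  Submodule.span ℂ (Set.range fun (g : G) (x : G ⧸ K) => φ (g⁻¹ • x))

/-- The dimension of the representation generated by `φ`. -/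
noncomputable def sphericalDim {G : Type*} [Group G] (K : Subgroup G) (φ : G ⧸ K → ℂ) : ℕ :=
  Module.finrank ℂ (translateSpan K φ)

/-- The value at the spherical function `φ` of the spherical Fourier transform of `μ`. -/
noncomputable def sphericalFourier {G : Type*} [Group G] (K : Subgroup G) [Fintype (G ⧸ K)]
    (μ : G ⧸ K → ℝ) (φ : G ⧸ K → ℂ) : ℂ :=
  ∑ x : G ⧸ K, (μ x : ℂ) * (starRingEnd ℂ) (φ x)

/-- Convolution on `X = G ⧸ K`: a distribution `μ` on `X` is identified with the right
`K`-invariant distribution `g ↦ μ (g K) / |K|` on `G`; convolving on `G` and projecting to `X`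
gives `(μ * ν)(x) = |K|⁻¹ ∑ u, μ (u K) * ν (u⁻¹ x)`. -/
noncomputable def quotConv {G : Type*} [Group G] [Fintype G] (K : Subgroup G)
    (μ ν : G ⧸ K → ℝ) : G ⧸ K → ℝ :=
  fun x => (Nat.card K : ℝ)⁻¹ * ∑ u : G, μ (u : G ⧸ K) * ν (u⁻¹ • x)

/-- The `t`-fold self-convolution on `X`, starting from the point mass at the coset `K`. -/
noncomputable def quotConvPow {G : Type*} [Group G] [Fintype G] (K : Subgroup G)
    [DecidableEq (G ⧸ K)] (μ : G ⧸ K → ℝ) : ℕ → (G ⧸ K → ℝ)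
  | 0 => fun x => if x = ((1 : G) : G ⧸ K) then 1 else 0
  | t + 1 => quotConv K (quotConvPow K μ t) μ

/-- Total variation distance of two distributions on a finite set. -/
noncomputable def tvDist {X : Type*} [Fintype X] (μ ν : X → ℝ) : ℝ :=
  (1 / 2) * ∑ x : X, |μ x - ν x|

/-- The uniform distribution on a finite set. -/
noncomputable def unif (X : Type*) [Fintype X] : X → ℝ :=
  fun _ => (Fintype.card X : ℝ)⁻¹

end GelfandWalk

/-! Commutativity makes the spherical functions an orthogonal basis of the bi-invariant functions.
The operators of convolution by self-adjoint bi-invariant functions are commuting and symmetric, so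
they are jointly diagonalisable, and averaging a joint eigenvector over `K` gives a multiple of a
spherical function (`IsBiInvariant.mem_span_isSpherical`). A trace computation gives `d_i * ‖φ_i‖² =
|X|`. The point mass at `K` is therefore `|X|⁻¹ ∑ d_i φ_i`, and each convolution by `μ` multiplies
the `i`-th term by its Fourier coefficient. The term `i = 0` is the uniform distribution. Dropping
the terms outside `I` costs at most their mean absolute values, and Cauchy–Schwarz bounds the mean
of `d_i |φ_i|` by `√d_i`.

The point `xbar` need not be the coset `K`, so `P^t xbar` and `μ^{*t}` may differ as distributions.
The map `R : gK ↦ g • xbar` is an equivariant permutation, and it preserves `P` because invariant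
matrices commute. Both distributions are then relabelings of the row of `P^t` at `K`, hence equally
far from uniform. -/

namespace GelfandWalk

open Finset Module.End

/-! ### Bi-invariant functions and the involution. -/

section BiInvariant

variable {G : Type*} [Group G] {K : Subgroup G}

/-- The involution `f ↦ (g ↦ conj (f g⁻¹))` of the convolution algebra. -/
def convStar (f : G → ℂ) : G → ℂ := fun g => (starRingEnd ℂ) (f g⁻¹)

theorem convStar_convStar (f : G → ℂ) : convStar (convStar f) = f := by
  funext g; simp [convStar]

theorem IsBiInvariant.convStar {f : G → ℂ} (hf : IsBiInvariant K f) :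
    IsBiInvariant K (convStar f) := by
  intro k₁ h₁ k₂ h₂ g
  have := hf k₂⁻¹ (K.inv_mem h₂) k₁⁻¹ (K.inv_mem h₁) g⁻¹
  simp only [GelfandWalk.convStar, mul_inv_rev, ← mul_assoc, this]

theorem IsBiInvariant.left {f : G → ℂ} (hf : IsBiInvariant K f) :
    ∀ k ∈ K, ∀ g, f (k * g) = f g := fun k hk g => by
  simpa using hf k hk 1 K.one_mem g

theorem IsBiInvariant.right {f : G → ℂ} (hf : IsBiInvariant K f) :
    ∀ k ∈ K, ∀ g, f (g * k) = f g := fun k hk g => by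
  simpa using hf 1 K.one_mem k hk g

theorem IsBiInvariant.smul {f : G → ℂ} (hf : IsBiInvariant K f) (c : ℂ) :
    IsBiInvariant K (c • f) := fun k₁ h₁ k₂ h₂ g => by
  simp [hf k₁ h₁ k₂ h₂ g]

theorem IsBiInvariant.add {f h : G → ℂ} (hf : IsBiInvariant K f) (hh : IsBiInvariant K h) :
    IsBiInvariant K (f + h) := fun k₁ h₁ k₂ h₂ g => by
  simp [hf k₁ h₁ k₂ h₂ g, hh k₁ h₁ k₂ h₂ g]

end BiInvariant

/-! ### The convolution algebra and orthogonality of spherical functions. -/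

section Convolution

variable {G : Type*} [Group G] [Fintype G]

theorem conv_apply_eq_sum_mul_inv (f h : G → ℂ) (g : G) :
    conv f h g = ∑ u : G, f (g * u⁻¹) * h u := by
  unfold conv
  refine Fintype.sum_equiv ((Equiv.inv G).trans (Equiv.mulRight g)) _ _ fun u => ?_
  simp

theorem conv_assoc (f h k : G → ℂ) : conv (conv f h) k = conv f (conv h k) := by
  funext g
  simp only [conv, Finset.sum_mul, Finset.mul_sum]
  rw [Finset.sum_comm]
  refine Finset.sum_congr rfl fun v _ => ?_
  refine Fintype.sum_equiv (Equiv.mulLeft v⁻¹) _ _ fun u => ?_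
  simp [mul_assoc]

theorem conv_add_left (f₁ f₂ h : G → ℂ) : conv (f₁ + f₂) h = conv f₁ h + conv f₂ h := by
  funext g; simp [conv, add_mul, Finset.sum_add_distrib]

theorem conv_add_right (f h₁ h₂ : G → ℂ) : conv f (h₁ + h₂) = conv f h₁ + conv f h₂ := by
  funext g; simp [conv, mul_add, Finset.sum_add_distrib]

theorem conv_smul_left (c : ℂ) (f h : G → ℂ) : conv (c • f) h = c • conv f h := by
  funext g; simp [conv, Finset.mul_sum, mul_assoc]

theorem conv_smul_right (c : ℂ) (f h : G → ℂ) : conv f (c • h) = c • conv f h := by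
  funext g; simp [conv, Finset.mul_sum, mul_left_comm]

theorem conv_sum_left {ι : Type*} (s : Finset ι) (f : ι → G → ℂ) (h : G → ℂ) :
    conv (∑ i ∈ s, f i) h = ∑ i ∈ s, conv (f i) h := by
  funext g
  simp only [conv, Finset.sum_apply, Finset.sum_mul]
  rw [Finset.sum_comm]

theorem convStar_conv (f h : G → ℂ) :
    convStar (conv f h) = conv (convStar h) (convStar f) := by
  funext g
  rw [convStar, conv_apply_eq_sum_mul_inv]
  simp only [convStar, conv, map_sum, map_mul]
  refine Fintype.sum_equiv (Equiv.inv G) _ _ fun u => ?_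
  simp [mul_comm]

theorem conv_convStar_apply_one (f : G → ℂ) :
    conv f (convStar f) 1 = ((∑ g : G, ‖f g‖ ^ 2 : ℝ) : ℂ) := by
  simp [conv, convStar, Complex.mul_conj']

theorem eq_zero_of_conv_convStar_apply_one (f : G → ℂ) (h : conv f (convStar f) 1 = 0) :
    f = 0 := by
  rw [conv_convStar_apply_one, Complex.ofReal_eq_zero,
    Finset.sum_eq_zero_iff_of_nonneg fun _ _ => by positivity] at h
  funext g
  simpa using h g (Finset.mem_univ g)

variable {K : Subgroup G}

theorem IsBiInvariant.conv {f h : G → ℂ} (hf : ∀ k ∈ K, ∀ g, f (k * g) = f g)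
    (hh : ∀ k ∈ K, ∀ g, h (g * k) = h g) : IsBiInvariant K (conv f h) := by
  intro k₁ h₁ k₂ h₂ g
  simp only [GelfandWalk.conv]
  refine Fintype.sum_equiv (Equiv.mulLeft k₁⁻¹) _ _ fun u => ?_
  simp only [Equiv.coe_mulLeft, hf _ (K.inv_mem h₁), mul_inv_rev, inv_inv, ← mul_assoc, hh _ h₂]

/-- By commutativity the product is a multiple of both `φ` and `ψ`, with the same scalar, its value
at `1`. A nonzero scalar would force `φ = ψ`. -/
theorem conv_eq_zero_of_isSpherical_of_ne (hGK : IsGelfandPair G K) {φ ψ : G → ℂ}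
    (hφ : IsSpherical K φ) (hψ : IsSpherical K ψ) (hne : φ ≠ ψ) : conv φ ψ = 0 := by
  have hcomm := hGK φ ψ hφ.1 hψ.1
  have h₁ := hφ.2.2 ψ hψ.1
  have h₂ := hψ.2.2 φ hφ.1
  rw [← hcomm, h₁] at h₂
  rw [h₁]
  by_contra h
  have hc : conv φ ψ 1 ≠ 0 := fun h0 => h (by rw [h0, zero_smul])
  have h₃ : (conv φ ψ 1 • φ) 1 = conv φ ψ 1 := by simp [hφ.2.1]
  rw [h₃] at h₂
  exact hne (smul_right_injective _ hc h₂)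

theorem IsSpherical.convStar (hGK : IsGelfandPair G K) {φ : G → ℂ} (hφ : IsSpherical K φ) :
    IsSpherical K (convStar φ) := by
  refine ⟨hφ.1.convStar, by simp [GelfandWalk.convStar, hφ.2.1], fun f hf => ?_⟩
  have key : GelfandWalk.conv (GelfandWalk.convStar φ) f =
      (starRingEnd ℂ) (GelfandWalk.conv φ (GelfandWalk.convStar f) 1) •
        GelfandWalk.convStar φ := by
    rw [← convStar_convStar f, ← convStar_conv,
      hGK _ _ hf.convStar hφ.1,
      hφ.2.2 _ hf.convStar, convStar_convStar]
    funext g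
    simp [GelfandWalk.convStar]
  rw [key]
  congr 1
  simp [GelfandWalk.convStar, hφ.2.1]

theorem IsSpherical.conv_convStar_apply_one_ne_zero {φ : G → ℂ} (hφ : IsSpherical K φ) :
    conv φ (GelfandWalk.convStar φ) 1 ≠ 0 := fun h => by
  have h1 := hφ.2.1
  simp [eq_zero_of_conv_convStar_apply_one φ h] at h1

/-- The product of `φ` with its spherical adjoint takes the value `∑ ‖φ g‖² ≠ 0` at `1`, so
orthogonality excludes that the two are distinct. -/
theorem IsSpherical.convStar_eq (hGK : IsGelfandPair G K) {φ : G → ℂ} (hφ : IsSpherical K φ) :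
    GelfandWalk.convStar φ = φ := by
  by_contra h
  have := conv_eq_zero_of_isSpherical_of_ne hGK hφ (hφ.convStar hGK) (Ne.symm h)
  exact hφ.conv_convStar_apply_one_ne_zero (by simp [this])

end Convolution

/-! ### Completeness of the spherical functions. -/

section Completeness

variable {G : Type*} [Group G] [Fintype G] {K : Subgroup G}

open scoped Classical in
/-- The normalized indicator of `K`, the unit of the algebra of bi-invariant functions. -/
noncomputable def convUnit (K : Subgroup G) : G → ℂ :=
  fun g => if g ∈ K then (Nat.card K : ℂ)⁻¹ else 0

omit [Fintype G] in
theorem convUnit_isBiInvariant : IsBiInvariant K (convUnit K) := by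
  intro k₁ h₁ k₂ h₂ g
  classical
  exact if_congr (by rw [K.mul_mem_cancel_right h₂, K.mul_mem_cancel_left h₁]) rfl rfl

theorem convUnit_conv {f : G → ℂ} (hf : ∀ k ∈ K, ∀ g, f (k * g) = f g) :
    conv (convUnit K) f = f := by
  classical
  funext g
  have : ∀ u : G, convUnit K u * f (u⁻¹ * g) = if u ∈ K then (Nat.card K : ℂ)⁻¹ * f g else 0 := by
    intro u
    unfold convUnit
    split_ifs with hu
    · rw [hf _ (K.inv_mem hu)]
    · simp
  simp only [conv, this]
  rw [← Finset.sum_filter, Finset.sum_const, nsmul_eq_mul, ← mul_assoc]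
  have hc : (#{u : G | u ∈ K} : ℂ) = Nat.card K := by
    rw [Nat.card_eq_fintype_card, Fintype.card_subtype]
  rw [hc, mul_inv_cancel₀ (by simp), one_mul]

theorem conv_convUnit_isRightInvariant (h : G → ℂ) :
    ∀ k ∈ K, ∀ g, conv h (convUnit K) (g * k) = conv h (convUnit K) g := by
  intro k hk g
  simp only [conv, ← mul_assoc, convUnit_isBiInvariant.right k hk]

/-- The matrix of left convolution by `f`. -/
def convMatrix (f : G → ℂ) : Matrix G G ℂ := Matrix.of fun g u => f (g * u⁻¹)

theorem convMatrix_mulVec (f h : G → ℂ) : (convMatrix f).mulVec h = conv f h := by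
  funext g
  simp [Matrix.mulVec, dotProduct, convMatrix, conv_apply_eq_sum_mul_inv]

/-- A joint eigenvector of the algebra of bi-invariant functions lying in this algebra is a
multiple of a spherical function. -/
theorem mem_span_isSpherical_of_conv_eq_smul (hGK : IsGelfandPair G K) {ψ : G → ℂ}
    (hψ : IsBiInvariant K ψ) (h : ∀ f, IsBiInvariant K f → ∃ c : ℂ, conv f ψ = c • ψ) :
    ψ ∈ Submodule.span ℂ {φ : G → ℂ | IsSpherical K φ} := by
  by_cases h1 : ψ 1 = 0
  -- The squared norm of `ψ` is the value at `1` of `c • ψ`, which is zero.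
  · obtain ⟨c, hc⟩ := h _ hψ.convStar
    rw [hGK _ _ hψ.convStar hψ] at hc
    rw [eq_zero_of_conv_convStar_apply_one ψ (by simp [hc, h1])]
    exact Submodule.zero_mem _
  · have hsph : IsSpherical K ((ψ 1)⁻¹ • ψ) := by
      refine ⟨hψ.smul _, by simp [h1], fun f hf => ?_⟩
      obtain ⟨c, hc⟩ := h f hf
      rw [conv_smul_left, hGK _ _ hψ hf, hc]
      funext g
      simp only [Pi.smul_apply, smul_eq_mul]
      field_simp
    have := Submodule.smul_mem _ (ψ 1) (Submodule.subset_span (s := {φ | IsSpherical K φ}) hsph)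
    rwa [smul_smul, mul_inv_cancel₀ h1, one_smul] at this

/-- Every bi-invariant function is a linear combination of spherical functions. -/
theorem IsBiInvariant.mem_span_isSpherical (hGK : IsGelfandPair G K) {f : G → ℂ}
    (hf : IsBiInvariant K f) : f ∈ Submodule.span ℂ {φ : G → ℂ | IsSpherical K φ} := by
  classical
  -- Self-adjointness of `f` is what makes its convolution operator symmetric.
  let S := {f : G → ℂ // IsBiInvariant K f ∧ GelfandWalk.convStar f = f}
  let T : S → EuclideanSpace ℂ G →ₗ[ℂ] EuclideanSpace ℂ G :=
    fun f => Matrix.toEuclideanLin (convMatrix f.1)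
  have hT : ∀ (f : S) (h : EuclideanSpace ℂ G), T f h = WithLp.toLp 2 (GelfandWalk.conv f.1 h) :=
    fun f h => by
      rw [← convMatrix_mulVec]; rfl
  have hsymm : ∀ f, (T f).IsSymmetric := by
    intro f
    rw [Matrix.isSymmetric_toEuclideanLin_iff]
    ext g u
    have := congrFun f.2.2 (g * u⁻¹)
    simpa [convMatrix, GelfandWalk.convStar] using this
  have hcomm : ∀ f h, Commute (T f) (T h) := by
    intro f h
    refine LinearMap.ext fun v => ?_
    simp only [Module.End.mul_apply, hT]
    rw [← conv_assoc, ← conv_assoc, hGK _ _ f.2.1 h.2.1]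
  have htop := LinearMap.IsSymmetric.iSup_iInf_eq_top_of_commute hsymm
    (fun f h _ => hcomm f h)
  -- Joint eigenvectors need not be bi-invariant. Two-sided averaging over `K` makes them so and
  -- keeps the eigenvalues, since the unit commutes with bi-invariant functions.
  let B : EuclideanSpace ℂ G →ₗ[ℂ] (G → ℂ) :=
    { toFun := fun h => GelfandWalk.conv (convUnit K) (GelfandWalk.conv h (convUnit K))
      map_add' := fun a b => by
        rw [WithLp.ofLp_add, conv_add_left, conv_add_right]
      map_smul' := fun c a => by
        rw [WithLp.ofLp_smul, conv_smul_left, conv_smul_right, RingHom.id_apply] }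
  have hB : ∀ h, B h = GelfandWalk.conv (convUnit K) (GelfandWalk.conv h (convUnit K)) :=
    fun _ => rfl
  have hBinv : ∀ h, IsBiInvariant K (B h) := fun h =>
    IsBiInvariant.conv convUnit_isBiInvariant.left (conv_convUnit_isRightInvariant _)
  have hle : ∀ h, B h ∈ Submodule.span ℂ {φ : G → ℂ | IsSpherical K φ} := by
    intro h
    have hmem : h ∈ (⊤ : Submodule ℂ (EuclideanSpace ℂ G)) := trivial
    rw [← htop] at hmem
    refine (iSup_le fun χ => ?_ :
      _ ≤ (Submodule.span ℂ {φ : G → ℂ | IsSpherical K φ}).comap B) hmem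
    intro v hv
    rw [Submodule.mem_iInf] at hv
    refine mem_span_isSpherical_of_conv_eq_smul hGK (hBinv v) ?_
    have herm : ∀ f : S, GelfandWalk.conv f.1 (B v) = χ f • B v := by
      intro f
      have h1 := mem_eigenspace_iff.1 (hv f)
      rw [hT] at h1
      have h2 : GelfandWalk.conv f.1 v = χ f • (v : G → ℂ) := congrArg WithLp.ofLp h1
      rw [hB, ← conv_assoc, hGK _ _ f.2.1 convUnit_isBiInvariant, conv_assoc,
        ← conv_assoc f.1, h2, conv_smul_left, conv_smul_right]
    intro f hf
    -- Twice the real part and, up to sign, twice the imaginary part of `f` for the involution.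
    let a : S := ⟨f + GelfandWalk.convStar f, hf.add hf.convStar, by
      funext g; simp [GelfandWalk.convStar, add_comm]⟩
    let b : S := ⟨Complex.I • (f + (-1 : ℂ) • GelfandWalk.convStar f),
      (hf.add (hf.convStar.smul _)).smul _, by
        funext g; simp [GelfandWalk.convStar]; ring⟩
    have hab : f = (1 / 2 : ℂ) • a.1 + (-(Complex.I / 2)) • b.1 := by
      funext g
      simp only [a, b, Pi.add_apply, Pi.smul_apply, smul_eq_mul]
      linear_combination (1 / 2 : ℂ) *
        (f g + -1 * GelfandWalk.convStar f g) * Complex.I_mul_I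
    refine ⟨1 / 2 * χ a + -(Complex.I / 2) * χ b, ?_⟩
    conv_lhs => rw [hab]
    rw [conv_add_left, conv_smul_left, conv_smul_left, herm, herm, smul_smul, smul_smul, add_smul]
  have := hle (WithLp.toLp 2 f)
  rw [hB] at this
  rwa [hGK _ _ hf convUnit_isBiInvariant, convUnit_conv hf.left, convUnit_conv hf.left] at this

end Completeness

/-! ### Dimension formula, Fourier inversion and truncation on the quotient. -/

section Quotient

variable {G : Type*} [Group G] {K : Subgroup G}

theorem isBiInvariant_lift {f : G ⧸ K → ℂ} (hf : ∀ k ∈ K, ∀ x, f (k • x) = f x) :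
    IsBiInvariant K (lift K f) := by
  intro k₁ h₁ k₂ h₂ g
  have : ((k₁ * g * k₂ : G) : G ⧸ K) = k₁ • (g : G ⧸ K) := by
    rw [QuotientGroup.mk_mul_of_mem _ h₂]; rfl
  simp only [lift, this, hf _ h₁]

theorem lift_injective : Function.Injective (lift K) := by
  intro f h hfh
  funext x
  induction x using QuotientGroup.induction_on with
  | H g => exact congrFun hfh g

variable [Fintype G] [Fintype (G ⧸ K)]

theorem sum_coe_eq_card_nsmul {M : Type*} [AddCommMonoid M] (F : G ⧸ K → M) :
    ∑ u : G, F (u : G ⧸ K) = Nat.card K • ∑ x, F x := by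
  classical
  have h : ∑ u : G, F (u : G ⧸ K) = ∑ p : (G ⧸ K) × K, F p.1 := by
    refine Fintype.sum_equiv Subgroup.groupEquivQuotientProdSubgroup _ _ fun u => ?_
    rfl
  rw [h, Fintype.sum_prod_type_right]
  simp [Nat.card_eq_fintype_card]

theorem card_eq_card_mul_card_quotient :
    Fintype.card G = Nat.card K * Fintype.card (G ⧸ K) := by
  have := sum_coe_eq_card_nsmul (K := K) (fun _ => (1 : ℕ))
  simpa using this

theorem conv_lift_convStar_lift_apply_one (φ : G ⧸ K → ℂ) :
    conv (lift K φ) (convStar (lift K φ)) 1 = Nat.card K * ((∑ x, ‖φ x‖ ^ 2 : ℝ) : ℂ) := by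
  rw [conv_convStar_apply_one]
  have := sum_coe_eq_card_nsmul (K := K) (fun x => ‖φ x‖ ^ 2)
  simp only [lift, this]
  simp

/-- Since `φ * φ = c φ`, right convolution by `c⁻¹ φ` is a projection onto the span of translates,
so its trace is the dimension. Each diagonal entry is `c⁻¹ |K|` because `φ` is `1` at the base
coset. -/
theorem sphericalDim_mul_conv (hGK : IsGelfandPair G K) {φ : G ⧸ K → ℂ}
    (hφ : IsSpherical K (lift K φ)) :
    (sphericalDim K φ : ℂ) * conv (lift K φ) (lift K φ) 1 = Fintype.card G := by
  classical
  set c := conv (lift K φ) (lift K φ) 1 with hc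
  have hc0 : c ≠ 0 := by
    have := hφ.conv_convStar_apply_one_ne_zero
    rwa [hφ.convStar_eq hGK] at this
  have hconv : conv (lift K φ) (lift K φ) = c • lift K φ := hφ.2.2 _ hφ.1
  let T : (G ⧸ K → ℂ) →ₗ[ℂ] (G ⧸ K → ℂ) :=
    { toFun := fun f x => c⁻¹ * ∑ u : G, f u * φ (u⁻¹ • x)
      map_add' := fun a b => by
        funext x; simp [add_mul, Finset.sum_add_distrib, mul_add]
      map_smul' := fun r a => by
        funext x; simp [mul_assoc, ← Finset.mul_sum, mul_left_comm] }
  have hT : ∀ f x, T f x = c⁻¹ * ∑ u : G, f u * φ (u⁻¹ • x) := fun _ _ => rfl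
  have hproj : LinearMap.IsProj (translateSpan K φ) T := by
    refine ⟨fun f => ?_, fun f hf => ?_⟩
    · have : T f = ∑ u : G, (c⁻¹ * f u) • fun x : G ⧸ K => φ (u⁻¹ • x) := by
        funext x
        simp [hT, Finset.mul_sum, mul_assoc]
      rw [this]
      exact Submodule.sum_mem _ fun u _ =>
        Submodule.smul_mem _ _ (Submodule.subset_span ⟨u, rfl⟩)
    · induction hf using Submodule.span_induction with
      | mem f hf =>
        obtain ⟨g, rfl⟩ := hf
        funext x
        induction x using QuotientGroup.induction_on with
        | H h =>
          have h1 := congrFun hconv (g⁻¹ * h)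
          have h2 : ∑ u : G, φ (g⁻¹ • (u : G ⧸ K)) * φ (u⁻¹ • (h : G ⧸ K)) =
              conv (lift K φ) (lift K φ) (g⁻¹ * h) := by
            refine Fintype.sum_equiv (Equiv.mulLeft g⁻¹) _ _ fun u => ?_
            simp [lift, mul_assoc]
          rw [hT, h2, h1, Pi.smul_apply, smul_eq_mul, inv_mul_cancel_left₀ hc0]
          rfl
      | zero => simp
      | add a b _ _ ha hb => rw [map_add, ha, hb]
      | smul r a _ ha => rw [map_smul, ha]
  have htr := hproj.trace
  have htr' : LinearMap.trace ℂ _ T = c⁻¹ * Fintype.card G := by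
    rw [LinearMap.trace_eq_matrix_trace ℂ (Pi.basisFun ℂ (G ⧸ K)), Matrix.trace]
    have hdiag : ∀ x : G ⧸ K, (LinearMap.toMatrix (Pi.basisFun ℂ (G ⧸ K))
        (Pi.basisFun ℂ (G ⧸ K)) T).diag x = c⁻¹ * ∑ u : G, if (u : G ⧸ K) = x then 1 else 0 := by
      intro x
      rw [Matrix.diag_apply, LinearMap.toMatrix_apply, Pi.basisFun_repr, Pi.basisFun_apply, hT]
      congr 1
      refine Finset.sum_congr rfl fun u _ => ?_
      rw [Pi.single_apply]
      split_ifs with hux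
      · subst hux
        have h1 : φ ((1 : G) : G ⧸ K) = 1 := hφ.2.1
        rw [MulAction.Quotient.smul_coe, smul_eq_mul, inv_mul_cancel, h1, mul_one]
      · rw [zero_mul]
    simp only [hdiag]
    rw [← Finset.mul_sum, Finset.sum_comm]
    simp
  rw [htr'] at htr
  unfold sphericalDim
  rw [← htr, mul_right_comm, inv_mul_cancel₀ hc0, one_mul]

/-- The squared norm of a spherical function is `|X|` divided by its dimension. -/
theorem sphericalDim_mul_sum_norm_sq (hGK : IsGelfandPair G K) {φ : G ⧸ K → ℂ}
    (hφ : IsSpherical K (lift K φ)) :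
    (sphericalDim K φ : ℝ) * ∑ x, ‖φ x‖ ^ 2 = Fintype.card (G ⧸ K) := by
  have h := sphericalDim_mul_conv hGK hφ
  have h1 := conv_lift_convStar_lift_apply_one φ
  rw [hφ.convStar_eq hGK] at h1
  rw [h1, card_eq_card_mul_card_quotient (K := K), mul_left_comm, Nat.cast_mul] at h
  have h2 := mul_left_cancel₀ (Nat.cast_ne_zero.2 Nat.card_pos.ne') h
  exact_mod_cast h2

/-- Cauchy–Schwarz bound for the mean of the absolute value of a spherical function. -/
theorem sphericalDim_mul_mean_norm_le (hGK : IsGelfandPair G K) {φ : G ⧸ K → ℂ}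
    (hφ : IsSpherical K (lift K φ)) :
    (sphericalDim K φ : ℝ) * ((Fintype.card (G ⧸ K) : ℝ)⁻¹ * ∑ x, ‖φ x‖) ≤
      √(sphericalDim K φ) := by
  have hcard : (0 : ℝ) < Fintype.card (G ⧸ K) := by exact_mod_cast Fintype.card_pos
  have h := sphericalDim_mul_sum_norm_sq hGK hφ
  have hcs : (∑ x, ‖φ x‖) ^ 2 ≤ Fintype.card (G ⧸ K) * ∑ x, ‖φ x‖ ^ 2 :=
    sq_sum_le_card_mul_sum_sq
  apply Real.le_sqrt_of_sq_le
  have hd : (0 : ℝ) ≤ sphericalDim K φ := Nat.cast_nonneg _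
  calc ((sphericalDim K φ : ℝ) * ((Fintype.card (G ⧸ K) : ℝ)⁻¹ * ∑ x, ‖φ x‖)) ^ 2
      = (sphericalDim K φ : ℝ) ^ 2 * (Fintype.card (G ⧸ K) : ℝ)⁻¹ ^ 2 * (∑ x, ‖φ x‖) ^ 2 := by
        ring
    _ ≤ (sphericalDim K φ : ℝ) ^ 2 * (Fintype.card (G ⧸ K) : ℝ)⁻¹ ^ 2 *
        (Fintype.card (G ⧸ K) * ∑ x, ‖φ x‖ ^ 2) := by gcongr
    _ = (sphericalDim K φ : ℝ) * (Fintype.card (G ⧸ K) : ℝ)⁻¹ ^ 2 * Fintype.card (G ⧸ K) *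
        (sphericalDim K φ * ∑ x, ‖φ x‖ ^ 2) := by ring
    _ = sphericalDim K φ := by rw [h]; field_simp

/-- The eigenvalue is `∑ μ(u) φ(u⁻¹)` over `G`; self-adjointness of `φ` turns `φ(u⁻¹)` into a
conjugate, and passing to cosets produces `|K|`. -/
theorem conv_spherical_lift (hGK : IsGelfandPair G K) {φ : G ⧸ K → ℂ}
    (hφ : IsSpherical K (lift K φ)) {μ : G ⧸ K → ℝ} (hμ : ∀ k ∈ K, ∀ x, μ (k • x) = μ x) :
    conv (lift K φ) (lift K fun x => (μ x : ℂ)) =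
      (Nat.card K * sphericalFourier K μ φ) • lift K φ := by
  have hb : IsBiInvariant K (lift K fun x => (μ x : ℂ)) :=
    isBiInvariant_lift fun k hk x => by rw [hμ k hk]
  rw [hφ.2.2 _ hb, hGK _ _ hφ.1 hb]
  congr 1
  have := sum_coe_eq_card_nsmul (K := K) (fun x => (μ x : ℂ) * (starRingEnd ℂ) (φ x))
  rw [sphericalFourier, ← nsmul_eq_mul, ← this]
  refine Finset.sum_congr rfl fun u _ => ?_
  have h := congrFun (hφ.convStar_eq hGK) u⁻¹
  simp only [convStar, inv_inv] at h
  rw [mul_one, ← h]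
  rfl

variable {ι : Type*} [Fintype ι] {φ : ι → G ⧸ K → ℂ}

theorem pointMass_eq_sum_spherical [DecidableEq (G ⧸ K)] (hGK : IsGelfandPair G K)
    (hinj : Function.Injective φ)
    (hφ : Set.range (fun i => lift K (φ i)) = {f : G → ℂ | IsSpherical K f}) (x : G ⧸ K) :
    (if x = ((1 : G) : G ⧸ K) then 1 else 0 : ℂ) =
      (Fintype.card (G ⧸ K) : ℂ)⁻¹ * ∑ i, (sphericalDim K (φ i) : ℂ) * φ i x := by
  have hs : ∀ i, IsSpherical K (lift K (φ i)) := fun i => by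
    have : lift K (φ i) ∈ Set.range (fun i => lift K (φ i)) := ⟨i, rfl⟩
    rwa [hφ] at this
  have hK : (Nat.card K : ℂ) ≠ 0 := Nat.cast_ne_zero.2 Nat.card_pos.ne'
  have hmem := convUnit_isBiInvariant.mem_span_isSpherical hGK
  rw [← hφ, Submodule.mem_span_range_iff_exists_fun] at hmem
  obtain ⟨a, ha⟩ := hmem
  -- Convolving the expansion of the unit with `φ j` and evaluating at `1` isolates `a j`.
  have hcoef : ∀ j, Nat.card K * a j =
      (Fintype.card (G ⧸ K) : ℂ)⁻¹ * (sphericalDim K (φ j) : ℂ) := by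
    intro j
    have h1 := congrFun (convUnit_conv (K := K) (hs j).1.left) 1
    rw [← ha, conv_sum_left, Finset.sum_eq_single j, conv_smul_left, (hs j).2.1] at h1
    · have h2 := sphericalDim_mul_conv hGK (hs j)
      rw [card_eq_card_mul_card_quotient (K := K), Nat.cast_mul] at h2
      rw [Pi.smul_apply, smul_eq_mul] at h1
      have hX : (Fintype.card (G ⧸ K) : ℂ) ≠ 0 := Nat.cast_ne_zero.2 Fintype.card_pos.ne'
      rw [eq_inv_mul_iff_mul_eq₀ hX]
      linear_combination (sphericalDim K (φ j) : ℂ) * h1 - a j * h2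
    · intro i _ hij
      rw [conv_smul_left, conv_eq_zero_of_isSpherical_of_ne hGK (hs i) (hs j)
        fun h => hij (hinj (lift_injective h)), smul_zero]
    · simp
  induction x using QuotientGroup.induction_on with
  | H g =>
    have h1 : (if (g : G ⧸ K) = ((1 : G) : G ⧸ K) then 1 else 0 : ℂ) =
        Nat.card K * convUnit K g := by
      have : (g : G ⧸ K) = ((1 : G) : G ⧸ K) ↔ g ∈ K := by
        rw [eq_comm, QuotientGroup.eq]; simp
      by_cases hg : g ∈ K
      · rw [if_pos (this.2 hg), convUnit, if_pos hg, mul_inv_cancel₀ hK]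
      · rw [if_neg fun h => hg (this.1 h), convUnit, if_neg hg, mul_zero]
    rw [h1, ← ha, Finset.sum_apply, Finset.mul_sum, Finset.mul_sum]
    refine Finset.sum_congr rfl fun i _ => ?_
    rw [Pi.smul_apply, smul_eq_mul, ← mul_assoc, hcoef, mul_assoc]
    rfl

/-- Spherical Fourier inversion for convolution powers. -/
theorem quotConvPow_eq_sum_spherical [DecidableEq (G ⧸ K)] (hGK : IsGelfandPair G K)
    (hinj : Function.Injective φ)
    (hφ : Set.range (fun i => lift K (φ i)) = {f : G → ℂ | IsSpherical K f})
    {μ : G ⧸ K → ℝ} (hμ : ∀ k ∈ K, ∀ x, μ (k • x) = μ x) (t : ℕ) (x : G ⧸ K) :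
    (quotConvPow K μ t x : ℂ) = (Fintype.card (G ⧸ K) : ℂ)⁻¹ *
      ∑ i, (sphericalDim K (φ i) : ℂ) * φ i x * sphericalFourier K μ (φ i) ^ t := by
  have hs : ∀ i, IsSpherical K (lift K (φ i)) := fun i => by
    have : lift K (φ i) ∈ Set.range (fun i => lift K (φ i)) := ⟨i, rfl⟩
    rwa [hφ] at this
  induction t generalizing x with
  | zero =>
    simp only [quotConvPow, pow_zero, mul_one]
    rw [← pointMass_eq_sum_spherical hGK hinj hφ x]
    split_ifs <;> simp
  | succ t ih =>
    induction x using QuotientGroup.induction_on with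
    | H g =>
      have hK : (Nat.card K : ℂ) ≠ 0 := Nat.cast_ne_zero.2 Nat.card_pos.ne'
      have hl : (lift K fun x => (quotConvPow K μ t x : ℂ)) =
          ∑ i, ((Fintype.card (G ⧸ K) : ℂ)⁻¹ * ((sphericalDim K (φ i) : ℂ) *
            sphericalFourier K μ (φ i) ^ t)) • lift K (φ i) := by
        funext h
        simp only [lift, ih, Finset.sum_apply, Pi.smul_apply, smul_eq_mul, Finset.mul_sum]
        exact Finset.sum_congr rfl fun i _ => by ring
      have h1 : (quotConvPow K μ (t + 1) g : ℂ) = (Nat.card K : ℂ)⁻¹ *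
          conv (lift K fun x => (quotConvPow K μ t x : ℂ)) (lift K fun x => (μ x : ℂ)) g := by
        simp only [quotConvPow, quotConv, conv, lift]
        push_cast
        rfl
      rw [h1, hl, conv_sum_left, Finset.sum_apply, Finset.mul_sum, Finset.mul_sum]
      refine Finset.sum_congr rfl fun i _ => ?_
      rw [conv_smul_left, conv_spherical_lift hGK (hs i) hμ]
      simp only [Pi.smul_apply, smul_eq_mul, lift]
      field_simp
      ring

/-- Truncating a spherical expansion perturbs its total variation distance to uniform by at most
the sum of the neglected terms. -/
theorem abs_tvDist_unif_sub_le_of_eq_sum (hGK : IsGelfandPair G K)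
    (hφ : ∀ i, IsSpherical K (lift K (φ i))) [DecidableEq ι] {i₀ : ι} (h₀ : ∀ x, φ i₀ x = 1)
    {ν : G ⧸ K → ℝ} {a : ι → ℂ} (ha : a i₀ = 1)
    (hν : ∀ x, (ν x : ℂ) = (Fintype.card (G ⧸ K) : ℂ)⁻¹ *
      ∑ i, (sphericalDim K (φ i) : ℂ) * φ i x * a i)
    (I : Finset ι) (hI : i₀ ∉ I) :
    |tvDist ν (unif (G ⧸ K)) - (1 / 2) * (Fintype.card (G ⧸ K) : ℝ)⁻¹ *
        ∑ x, ‖∑ i ∈ I, (sphericalDim K (φ i) : ℂ) * φ i x * a i‖| ≤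
      (1 / 2) * ∑ i with i ≠ i₀ ∧ i ∉ I, √(sphericalDim K (φ i)) * ‖a i‖ := by
  set F : ι → G ⧸ K → ℂ := fun i x => (sphericalDim K (φ i) : ℂ) * φ i x * a i with hF
  have hX : (Fintype.card (G ⧸ K) : ℂ) ≠ 0 := Nat.cast_ne_zero.2 Fintype.card_pos.ne'
  -- The constant function has squared norm `|X|`.
  have hd₀ : (sphericalDim K (φ i₀) : ℂ) = 1 := by
    have h := sphericalDim_mul_sum_norm_sq hGK (hφ i₀)
    simp only [h₀, norm_one, one_pow, Finset.sum_const, Finset.card_univ, nsmul_eq_mul,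
      mul_one] at h
    have h' : (sphericalDim K (φ i₀) : ℂ) * Fintype.card (G ⧸ K) = Fintype.card (G ⧸ K) := by
      exact_mod_cast h
    exact (mul_eq_right₀ hX).1 h'
  have hsplit : ∀ x, ∑ i, F i x = 1 + (∑ i ∈ I, F i x + ∑ i with i ≠ i₀ ∧ i ∉ I, F i x) := by
    intro x
    rw [← Finset.add_sum_erase _ _ (Finset.mem_univ i₀)]
    congr 1
    · simp [hF, hd₀, h₀, ha]
    · rw [← Finset.sum_union]
      · congr 1
        ext i
        by_cases hi : i ∈ I
        · have : i ≠ i₀ := fun h => hI (h ▸ hi)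
          simp [hi, this]
        · simp [hi]
      · rw [Finset.disjoint_left]
        intro i hi h
        simp [hi] at h
  have hdiff : ∀ x, |ν x - unif (G ⧸ K) x| =
      (Fintype.card (G ⧸ K) : ℝ)⁻¹ * ‖∑ i ∈ I, F i x + ∑ i with i ≠ i₀ ∧ i ∉ I, F i x‖ := by
    intro x
    have h : ((ν x - unif (G ⧸ K) x : ℝ) : ℂ) = (Fintype.card (G ⧸ K) : ℂ)⁻¹ *
        (∑ i ∈ I, F i x + ∑ i with i ≠ i₀ ∧ i ∉ I, F i x) := by
      rw [Complex.ofReal_sub, hν x]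
      change _ * ∑ i, F i x - _ = _
      rw [hsplit x, unif]
      push_cast
      ring
    rw [← Real.norm_eq_abs, ← Complex.norm_real, h, norm_mul, norm_inv, Complex.norm_natCast]
  have hterm : ∀ x, |‖∑ i ∈ I, F i x + ∑ i with i ≠ i₀ ∧ i ∉ I, F i x‖ - ‖∑ i ∈ I, F i x‖| ≤
      ∑ i with i ≠ i₀ ∧ i ∉ I, (sphericalDim K (φ i) : ℝ) * ‖φ i x‖ * ‖a i‖ := by
    intro x
    refine (abs_norm_sub_norm_le _ _).trans ?_
    rw [add_sub_cancel_left]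
    refine (norm_sum_le _ _).trans_eq (Finset.sum_congr rfl fun i _ => ?_)
    simp [hF]
  simp only [tvDist, hdiff]
  rw [← Finset.mul_sum, ← mul_assoc, ← mul_sub, ← Finset.sum_sub_distrib, abs_mul,
    abs_of_nonneg (by positivity), mul_assoc]
  refine mul_le_mul_of_nonneg_left ?_ (by norm_num)
  calc _ ≤ (Fintype.card (G ⧸ K) : ℝ)⁻¹ * ∑ x, ∑ i with i ≠ i₀ ∧ i ∉ I,
        (sphericalDim K (φ i) : ℝ) * ‖φ i x‖ * ‖a i‖ := by
        refine mul_le_mul_of_nonneg_left ?_ (by positivity)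
        exact (Finset.abs_sum_le_sum_abs _ _).trans (Finset.sum_le_sum fun x _ => hterm x)
    _ = ∑ i with i ≠ i₀ ∧ i ∉ I, (sphericalDim K (φ i) : ℝ) *
        ((Fintype.card (G ⧸ K) : ℝ)⁻¹ * ∑ x, ‖φ i x‖) * ‖a i‖ := by
        rw [Finset.sum_comm, Finset.mul_sum]
        refine Finset.sum_congr rfl fun i _ => ?_
        rw [← Finset.sum_mul, ← Finset.mul_sum]
        ring
    _ ≤ _ := by
        refine Finset.sum_le_sum fun i _ => ?_
        exact mul_le_mul_of_nonneg_right (sphericalDim_mul_mean_norm_le hGK (hφ i))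
          (norm_nonneg _)

end Quotient

/-! ### Invariant matrices and the change of base point. -/

section Invariant

variable {G : Type*} [Group G] {K : Subgroup G}

/-- The map `gK ↦ g • x₀` is well defined as `K` fixes `x₀`, and surjective by transitivity, hence
bijective by finiteness. -/
theorem exists_equivariant_perm [Finite (G ⧸ K)] {x₀ : G ⧸ K} (hx₀ : ∀ k ∈ K, k • x₀ = x₀) :
    ∃ R : Equiv.Perm (G ⧸ K), R ((1 : G) : G ⧸ K) = x₀ ∧ ∀ (g : G) x, R (g • x) = g • R x := by
  let R : G ⧸ K → G ⧸ K := Quotient.lift (fun g : G => g • x₀) fun a b hab => by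
    have h := hx₀ _ (QuotientGroup.leftRel_apply.1 hab)
    calc a • x₀ = a • (a⁻¹ * b) • x₀ := by rw [h]
      _ = b • x₀ := by rw [smul_smul, mul_inv_cancel_left]
  have hR : ∀ g : G, R (g : G ⧸ K) = g • x₀ := fun _ => rfl
  have hequiv : ∀ (g : G) x, R (g • x) = g • R x := by
    intro g x
    induction x using QuotientGroup.induction_on with
    | H h => rw [MulAction.Quotient.smul_coe, hR, hR, smul_eq_mul, mul_smul]
  have hsurj : Function.Surjective R := fun y => by
    obtain ⟨g, hg⟩ := MulAction.exists_smul_eq G x₀ y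
    exact ⟨g, hg⟩
  exact ⟨Equiv.ofBijective R ⟨Finite.injective_iff_surjective.2 hsurj, hsurj⟩,
    (hR 1).trans (one_smul G x₀), hequiv⟩

variable [Fintype (G ⧸ K)]

theorem mul_apply_smul_smul {M N : Matrix (G ⧸ K) (G ⧸ K) ℝ}
    (hM : ∀ (g : G) (x y : G ⧸ K), M (g • x) (g • y) = M x y)
    (hN : ∀ (g : G) (x y : G ⧸ K), N (g • x) (g • y) = N x y) (g : G) (x y : G ⧸ K) :
    (M * N) (g • x) (g • y) = (M * N) x y := by
  simp only [Matrix.mul_apply]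
  refine (Fintype.sum_equiv (MulAction.toPerm g) _ _ fun z => ?_).symm
  simp [hM, hN]

theorem pow_apply_smul_smul [DecidableEq (G ⧸ K)] {M : Matrix (G ⧸ K) (G ⧸ K) ℝ}
    (hM : ∀ (g : G) (x y : G ⧸ K), M (g • x) (g • y) = M x y) (t : ℕ) (g : G) (x y : G ⧸ K) :
    (M ^ t) (g • x) (g • y) = (M ^ t) x y := by
  induction t generalizing g x y with
  | zero => simp [Matrix.one_apply]
  | succ t ih => rw [pow_succ]; exact mul_apply_smul_smul ih hM g x y

variable [Fintype G]

theorem card_mul_mul_apply_one {M N : Matrix (G ⧸ K) (G ⧸ K) ℝ}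
    (hN : ∀ (g : G) (x y : G ⧸ K), N (g • x) (g • y) = N x y) (h : G) :
    (Nat.card K : ℂ) * ((M * N) ((1 : G) : G ⧸ K) h : ℝ) =
      conv (lift K fun x => (M ((1 : G) : G ⧸ K) x : ℂ))
        (lift K fun x => (N ((1 : G) : G ⧸ K) x : ℂ)) h := by
  rw [Matrix.mul_apply, Complex.ofReal_sum, ← nsmul_eq_mul, ← sum_coe_eq_card_nsmul]
  refine Finset.sum_congr rfl fun u _ => ?_
  rw [Complex.ofReal_mul, ← hN u⁻¹ u h]
  simp [lift]

/-- The `G`-invariant matrices of a Gelfand pair commute. -/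
theorem mul_comm_of_invariant (hGK : IsGelfandPair G K) {M N : Matrix (G ⧸ K) (G ⧸ K) ℝ}
    (hM : ∀ (g : G) (x y : G ⧸ K), M (g • x) (g • y) = M x y)
    (hN : ∀ (g : G) (x y : G ⧸ K), N (g • x) (g • y) = N x y) : M * N = N * M := by
  have hb : ∀ {L : Matrix (G ⧸ K) (G ⧸ K) ℝ},
      (∀ (g : G) (x y : G ⧸ K), L (g • x) (g • y) = L x y) →
      IsBiInvariant K (lift K fun x => (L ((1 : G) : G ⧸ K) x : ℂ)) := by
    refine fun {L} hL => isBiInvariant_lift fun k hk x => ?_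
    have hk1 : k • ((1 : G) : G ⧸ K) = ((1 : G) : G ⧸ K) := by
      rw [MulAction.Quotient.smul_coe, smul_eq_mul, QuotientGroup.eq]
      simpa using hk
    rw [← hL k _ x, hk1]
  have hK : (Nat.card K : ℂ) ≠ 0 := Nat.cast_ne_zero.2 Nat.card_pos.ne'
  ext x y
  -- By transitivity only the base row matters, where the matrix product is a convolution.
  obtain ⟨g, rfl⟩ := MulAction.exists_smul_eq G ((1 : G) : G ⧸ K) x
  rw [← smul_inv_smul g y, mul_apply_smul_smul hM hN, mul_apply_smul_smul hN hM]
  induction g⁻¹ • y using QuotientGroup.induction_on with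
  | H h =>
    have h1 := card_mul_mul_apply_one (M := M) hN h
    rw [hGK _ _ (hb hM) (hb hN), ← card_mul_mul_apply_one hM h] at h1
    exact_mod_cast mul_left_cancel₀ hK h1

/-- Invariant matrices of a Gelfand pair are invariant under equivariant permutations. -/
theorem apply_perm_perm (hGK : IsGelfandPair G K) {M : Matrix (G ⧸ K) (G ⧸ K) ℝ}
    (hM : ∀ (g : G) (x y : G ⧸ K), M (g • x) (g • y) = M x y)
    {R : Equiv.Perm (G ⧸ K)} (hR : ∀ (g : G) x, R (g • x) = g • R x) (x y : G ⧸ K) :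
    M (R x) (R y) = M x y := by
  classical
  -- The permutation matrix of `R` is itself invariant; the entry of `Q * M = M * Q` at `(x, R y)`
  -- is the claim.
  let Q : Matrix (G ⧸ K) (G ⧸ K) ℝ := Matrix.of fun x y => if R x = y then 1 else 0
  have hQ : ∀ (g : G) (x y : G ⧸ K), Q (g • x) (g • y) = Q x y := by
    intro g x y
    simp [Q, hR]
  have h := congrFun (congrFun (mul_comm_of_invariant hGK hQ hM) x) (R y)
  simpa [Matrix.mul_apply, Q] using h

theorem quotConv_apply_row {M : Matrix (G ⧸ K) (G ⧸ K) ℝ}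
    (hM : ∀ (g : G) (x y : G ⧸ K), M (g • x) (g • y) = M x y)
    {R : Equiv.Perm (G ⧸ K)} (hR : ∀ (g : G) x, R (g • x) = g • R x)
    (α : G ⧸ K → ℝ) (x : G ⧸ K) :
    quotConv K α (M (R ((1 : G) : G ⧸ K))) x = ∑ y, α y * M (R y) x := by
  have hK : (Nat.card K : ℝ) ≠ 0 := Nat.cast_ne_zero.2 Nat.card_pos.ne'
  rw [quotConv, inv_mul_eq_iff_eq_mul₀ hK, ← nsmul_eq_mul, ← sum_coe_eq_card_nsmul]
  refine Finset.sum_congr rfl fun u _ => ?_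
  rw [← hM u, ← hR, smul_inv_smul]
  simp

/-- Convolving with the row at `R(K)` means applying `R` and then taking a step of `M`. As `R`
preserves `M`, the `t` copies of `R` collect into `R ^ t`. -/
theorem quotConvPow_row_perm_pow [DecidableEq (G ⧸ K)] (hGK : IsGelfandPair G K)
    {M : Matrix (G ⧸ K) (G ⧸ K) ℝ}
    (hM : ∀ (g : G) (x y : G ⧸ K), M (g • x) (g • y) = M x y)
    {R : Equiv.Perm (G ⧸ K)} (hR : ∀ (g : G) x, R (g • x) = g • R x) (t : ℕ) (x : G ⧸ K) :
    quotConvPow K (M (R ((1 : G) : G ⧸ K))) t ((R ^ t) x) = (M ^ t) ((1 : G) : G ⧸ K) x := by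
  induction t generalizing x with
  | zero => simp [quotConvPow, Matrix.one_apply, eq_comm]
  | succ t ih =>
    have hRt : ∀ s : ℕ, ∀ (g : G) x, (R ^ s) (g • x) = g • (R ^ s) x := by
      intro s
      induction s with
      | zero => simp
      | succ s ihs => intro g x; rw [pow_succ', Equiv.Perm.mul_apply, ihs, hR]; rfl
    rw [quotConvPow, quotConv_apply_row hM hR, pow_succ M, Matrix.mul_apply]
    refine (Fintype.sum_equiv (R ^ t) _ _ fun y => ?_).symm
    rw [ih, ← Equiv.Perm.mul_apply, ← pow_succ', apply_perm_perm hGK hM (hRt (t + 1))]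

theorem tvDist_unif_congr_perm {X : Type*} [Fintype X] {μ ν : X → ℝ} (e : Equiv.Perm X)
    (h : ∀ x, μ (e x) = ν x) : tvDist μ (unif X) = tvDist ν (unif X) := by
  unfold tvDist
  congr 1
  exact (Fintype.sum_equiv e _ _ fun x => by rw [h x]; rfl).symm

end Invariant

end GelfandWalk

theorem mainTheorem5 {G : Type*} [Group G] [Fintype G] (K : Subgroup G)
    [Fintype (G ⧸ K)] [DecidableEq (G ⧸ K)]
    (hGK : GelfandWalk.IsGelfandPair G K)
    -- the distinct spherical functions, viewed on the quotient, the first one being constant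
    (N : ℕ) (φ : Fin (N + 1) → (G ⧸ K → ℂ)) (hφ_inj : Function.Injective φ)
    (hφ : Set.range (fun i => GelfandWalk.lift K (φ i)) =
      {f : G → ℂ | GelfandWalk.IsSpherical K f})
    (hφ_zero : ∀ x, φ 0 x = 1)
    -- the starting point, stabilised by the subgroup
    (xbar : G ⧸ K) (hxbar : ∀ k ∈ K, k • xbar = xbar)
    -- the invariant stochastic matrix
    (P : Matrix (G ⧸ K) (G ⧸ K) ℝ) (hP : P ∈ Matrix.rowStochastic ℝ (G ⧸ K))
    (hP_inv : ∀ (g : G) (x y : G ⧸ K), P (g • x) (g • y) = P x y)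
    (t : ℕ) (I : Finset (Fin (N + 1))) (hI : 0 ∉ I) :
    GelfandWalk.tvDist ((P ^ t) xbar) (GelfandWalk.unif (G ⧸ K)) =
        GelfandWalk.tvDist (GelfandWalk.quotConvPow K (P xbar) t) (GelfandWalk.unif (G ⧸ K)) ∧
    |GelfandWalk.tvDist ((P ^ t) xbar) (GelfandWalk.unif (G ⧸ K)) -
        (1 / 2) * (Fintype.card (G ⧸ K) : ℝ)⁻¹ *
          ∑ x : G ⧸ K, ‖∑ i ∈ I, (GelfandWalk.sphericalDim K (φ i) : ℂ) * φ i x *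
            GelfandWalk.sphericalFourier K (P xbar) (φ i) ^ t‖| ≤
      (1 / 2) * ∑ i with i ≠ 0 ∧ i ∉ I, Real.sqrt (GelfandWalk.sphericalDim K (φ i) : ℝ) *
        ‖GelfandWalk.sphericalFourier K (P xbar) (φ i)‖ ^ t := by
  classical
  have hs : ∀ i, GelfandWalk.IsSpherical K (GelfandWalk.lift K (φ i)) := fun i => by
    have : GelfandWalk.lift K (φ i) ∈ Set.range (fun i => GelfandWalk.lift K (φ i)) := ⟨i, rfl⟩
    rwa [hφ] at this
  have hμ : ∀ k ∈ K, ∀ x, P xbar (k • x) = P xbar x := fun k hk x => by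
    rw [← hP_inv k xbar x, hxbar k hk]
  have htv : GelfandWalk.tvDist ((P ^ t) xbar) (GelfandWalk.unif (G ⧸ K)) =
      GelfandWalk.tvDist (GelfandWalk.quotConvPow K (P xbar) t) (GelfandWalk.unif (G ⧸ K)) := by
    obtain ⟨R, hR1, hR⟩ := GelfandWalk.exists_equivariant_perm hxbar
    rw [← hR1, GelfandWalk.tvDist_unif_congr_perm R fun x =>
        GelfandWalk.apply_perm_perm hGK (GelfandWalk.pow_apply_smul_smul hP_inv t) hR _ x,
      GelfandWalk.tvDist_unif_congr_perm (R ^ t) fun x =>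
        GelfandWalk.quotConvPow_row_perm_pow hGK hP_inv hR t x]
  refine ⟨htv, ?_⟩
  -- The coefficient at the constant function is the total mass of a row of `P`.
  have hone : GelfandWalk.sphericalFourier K (P xbar) (φ 0) = 1 := by
    have := (Matrix.mem_rowStochastic_iff_sum.1 hP).2 xbar
    simp only [GelfandWalk.sphericalFourier, hφ_zero, map_one, mul_one]
    exact_mod_cast this
  rw [htv]
  have := GelfandWalk.abs_tvDist_unif_sub_le_of_eq_sum hGK hs hφ_zero
    (a := fun i => GelfandWalk.sphericalFourier K (P xbar) (φ i) ^ t) (by simp [hone])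
    (GelfandWalk.quotConvPow_eq_sum_spherical hGK hφ_inj hφ hμ t) I hI
  simpa only [norm_pow] using this
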